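/- For a field $K$ and an integer $n\ge 1$ let $S=K[x_1,\dots,x_n]$ and let $S_d$ be the space of homogeneous polynomials of degree $d$ in $S$. For a subspace $V\subseteq S_d$ let $V^j\subseteq S_{jd}$ be the $K$-span of all products $f_1\cdots f_j$ with $f_1,\dots,f_j\in V$. For positive integers $n,d,u,j$ with $u\le\dim_K S_d=\binom{n+d-1}{d}$ let $$L_K(n,d,u,j)=\min\{\dim_K V^j : V\subseteq S_d \text{ a } K\text{-subspace with } \dim_K V=u\}.$$ A subspace $W\subseteq S_d$ is called strongly stable if it is spanned by monomials and, for every monomial $m\in W$ and all $i<k$ such that $x_k$ divides $m$, one has $m x_i/x_k\in W$. Proposition. Let $n,d,u,j$ be positive integers with $u\le\binom{n+d-1}{d}$. There exist a finite set $A$ of monomials of degree $d$ in $x_1,\dots,x_n$ and an integer $\ell$, both independent of the field, such that for every field $K$ the $K$-span $W$ of $A$ is a strongly stable $u$-dimensional subspace of $S_d$ and $$L_K(n,d,u,j)=\dim_K W^j=\ell.$$ -/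

import Mathlib

namespace PowersOfForms

open MvPolynomial

/-- The Grassmannian `G(u, S_d)`: the `u`-dimensional `K`-subspaces of the space `S_d` of
homogeneous polynomials of degree `d` in `S = K[x_1, ..., x_n]`. -/
def grassmannian (K : Type*) [Field K] (n d u : ℕ) :
    Set (Submodule K (MvPolynomial (Fin n) K)) :=
  {V | V ≤ homogeneousSubmodule (Fin n) K d ∧ Module.finrank K V = u}

/-- `L(n, d, u, j)` over `K`: the minimum of `dim V ^ j` over `V ∈ G(u, S_d)`, where `V ^ j` is the
`K`-span of the products of `j` elements of `V`. For a nonempty Grassmannian the infimum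
of this set of natural numbers is its minimum. -/
noncomputable def minPowerDim (K : Type*) [Field K] (n d u j : ℕ) : ℕ :=
  sInf {k | ∃ V ∈ grassmannian K n d u,
    k = Module.finrank K (V ^ j : Submodule K (MvPolynomial (Fin n) K))}

/-- The subspace of `K[x_1, ..., x_n]` spanned by the monomials with exponents in `A`. -/
noncomputable def monomialSubspace (K : Type*) [Field K] {n : ℕ} (A : Set (Fin n →₀ ℕ)) :
    Submodule K (MvPolynomial (Fin n) K) :=
  Submodule.span K ((fun m => monomial m (1 : K)) '' A)

/-- A subspace is strongly stable if it is spanned by monomials and, for each monomial `m` in it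
and all `i < k` such that `x_k` divides `m`, it contains `m * x_i / x_k`. -/
def IsStronglyStable {K : Type*} [Field K] {n : ℕ}
    (W : Submodule K (MvPolynomial (Fin n) K)) : Prop :=
  (∃ A : Set (Fin n →₀ ℕ), W = monomialSubspace K A) ∧
    ∀ m : Fin n →₀ ℕ, monomial m (1 : K) ∈ W → ∀ i k : Fin n, i < k → 0 < m k →
      monomial (m - Finsupp.single k 1 + Finsupp.single i 1) (1 : K) ∈ W

end PowersOfForms

namespace PowersOfForms

open Finset
open scoped Pointwise

/-! The leading exponents of `V` under a monomial order include `u` distinct vectors `A` of degree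
`d`. Sums of `j` of them are leading exponents of `V ^ j`, so `#(j • A)` bounds its dimension below,
with equality for monomial spaces. Hence the minimum is that of `#(j • A)` over `u`-sets of
exponents, where no field appears (`exists_card_nsmul_le_finrank_pow`, `minPowerDim_eq_card_nsmul`).

Strong stability comes from compression: `A` is cut into lines along `x_k → x_i`, and each slice is
pushed to an initial segment. By Cauchy-Davenport in ℕ this does not increase `#(j • A)`
(`card_nsmul_compress_le`), and it lowers the total weight unless all slices are already initial
segments. A minimizer of `#(j • A)` of least weight is therefore strongly stable. -/

variable {n : ℕ}

/-! ### Compression of sets of exponents -/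

/-- The exponent vector obtained by replacing every factor `x_k` by `x_i`. -/
noncomputable def moveVar (i k : Fin n) (m : Fin n →₀ ℕ) : Fin n →₀ ℕ :=
  m.erase k + Finsupp.single i (m k)

lemma moveVar_apply {i k : Fin n} (hik : i ≠ k) (m : Fin n →₀ ℕ) (t : Fin n) :
    moveVar i k m t = if t = k then 0 else if t = i then m i + m k else m t := by
  unfold moveVar
  rw [Finsupp.add_apply, Finsupp.erase_apply, Finsupp.single_apply]
  split_ifs <;> subst_vars <;> simp_all

lemma moveVar_add {i k : Fin n} (a b : Fin n →₀ ℕ) :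
    moveVar i k (a + b) = moveVar i k a + moveVar i k b := by
  simp only [moveVar, Finsupp.erase_add, Finsupp.add_apply, Finsupp.single_add]
  abel

/-- The exponent vector obtained by replacing a factor `x_i ^ c` by `x_k ^ c`. -/
noncomputable def transfer (i k : Fin n) (p : Fin n →₀ ℕ) (c : ℕ) : Fin n →₀ ℕ :=
  p - Finsupp.single i c + Finsupp.single k c

lemma transfer_apply {i k : Fin n} (hik : i ≠ k) (p : Fin n →₀ ℕ) (c : ℕ) (t : Fin n) :
    transfer i k p c t = if t = k then p k + c else if t = i then p i - c else p t := by
  unfold transfer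
  rw [Finsupp.add_apply, Finsupp.tsub_apply, Finsupp.single_apply, Finsupp.single_apply]
  split_ifs <;> subst_vars <;> simp_all

lemma transfer_moveVar {i k : Fin n} (hik : i ≠ k) (m : Fin n →₀ ℕ) :
    transfer i k (moveVar i k m) (m k) = m := by
  ext t
  simp only [transfer_apply hik, moveVar_apply hik]
  split_ifs <;> subst_vars <;> simp_all

lemma moveVar_transfer {i k : Fin n} (hik : i ≠ k) (a : Fin n →₀ ℕ) {c : ℕ}
    (hc : c ≤ moveVar i k a i) :
    moveVar i k (transfer i k (moveVar i k a) c) = moveVar i k a := by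
  rw [moveVar_apply hik, if_neg hik, if_pos rfl] at hc
  ext t
  simp only [transfer_apply hik, moveVar_apply hik]
  split_ifs <;> subst_vars <;> simp_all

lemma eq_of_moveVar_eq {i k : Fin n} (hik : i ≠ k) {a b : Fin n →₀ ℕ}
    (h : moveVar i k a = moveVar i k b) (hk : a k = b k) : a = b := by
  rw [← transfer_moveVar hik a, ← transfer_moveVar hik b, h, hk]

/-- The exponents of `x_k` in the members of `A` lying over `p`. -/
noncomputable def fiberExps (i k : Fin n) (A : Finset (Fin n →₀ ℕ)) (p : Fin n →₀ ℕ) : Finset ℕ :=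
  {m ∈ A | moveVar i k m = p}.image (fun m => m k)

lemma mem_fiberExps {i k : Fin n} {A : Finset (Fin n →₀ ℕ)} {p : Fin n →₀ ℕ} {b : ℕ} :
    b ∈ fiberExps i k A p ↔ ∃ m ∈ A, moveVar i k m = p ∧ m k = b := by
  simp [fiberExps, and_assoc]

lemma sum_fiberExps {i k : Fin n} (hik : i ≠ k) (A : Finset (Fin n →₀ ℕ)) (p : Fin n →₀ ℕ)
    (g : ℕ → ℕ) : ∑ b ∈ fiberExps i k A p, g b = ∑ m ∈ A with moveVar i k m = p, g (m k) := by
  refine sum_image ?_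
  intro a ha b hb hab
  simp only [coe_filter, Set.mem_ofPred_eq] at ha hb
  exact eq_of_moveVar_eq hik (ha.2.trans hb.2.symm) hab

/-- Over `p`, the variables `x_i` and `x_k` share `p i` factors. Thus the subtraction in `transfer`
never truncates when compressing. -/
lemma card_fiberExps_le {i k : Fin n} (hik : i ≠ k) (A : Finset (Fin n →₀ ℕ)) (p : Fin n →₀ ℕ) :
    #(fiberExps i k A p) ≤ p i + 1 := by
  rw [← card_range (p i + 1)]
  refine card_le_card fun b hb => ?_
  obtain ⟨m, -, rfl, rfl⟩ := mem_fiberExps.1 hb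
  rw [mem_range, moveVar_apply hik, if_neg hik, if_pos rfl]
  omega

lemma fiberExps_add_subset {i k : Fin n} (A B : Finset (Fin n →₀ ℕ)) (p q : Fin n →₀ ℕ) :
    fiberExps i k A p + fiberExps i k B q ⊆ fiberExps i k (A + B) (p + q) := by
  intro c hc
  obtain ⟨x, hx, y, hy, rfl⟩ := mem_add.1 hc
  obtain ⟨a, ha, rfl, rfl⟩ := mem_fiberExps.1 hx
  obtain ⟨b, hb, rfl, rfl⟩ := mem_fiberExps.1 hy
  exact mem_fiberExps.2 ⟨a + b, add_mem_add ha hb, moveVar_add a b, rfl⟩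

/-- The compression of `A` in direction `x_k → x_i`: over each `p` the exponents of `x_k` are
replaced by an initial segment of the natural numbers of the same size. -/
noncomputable def compress (i k : Fin n) (A : Finset (Fin n →₀ ℕ)) : Finset (Fin n →₀ ℕ) :=
  (A.image (moveVar i k)).biUnion fun p =>
    (range #(fiberExps i k A p)).image (transfer i k p)

lemma mem_compress {i k : Fin n} (hik : i ≠ k) {A : Finset (Fin n →₀ ℕ)} {m : Fin n →₀ ℕ} :
    m ∈ compress i k A ↔ m k < #(fiberExps i k A (moveVar i k m)) := by
  simp only [compress, mem_biUnion, mem_image, mem_range]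
  constructor
  · rintro ⟨_, ⟨a, ha, rfl⟩, c, hc, rfl⟩
    have hc' := hc.trans_le (card_fiberExps_le hik A _)
    rw [moveVar_transfer hik a (by omega), transfer_apply hik, if_pos rfl, moveVar_apply hik,
      if_pos rfl, zero_add]
    exact hc
  · intro h
    refine ⟨moveVar i k m, ?_, m k, h, transfer_moveVar hik m⟩
    obtain ⟨b, hb⟩ := card_pos.1 (Nat.zero_lt_of_lt h)
    obtain ⟨a, ha, hp, -⟩ := mem_fiberExps.1 hb
    exact ⟨a, ha, hp⟩

lemma fiberExps_compress {i k : Fin n} (hik : i ≠ k) (A : Finset (Fin n →₀ ℕ))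
    (p : Fin n →₀ ℕ) :
    fiberExps i k (compress i k A) p = range #(fiberExps i k A p) := by
  ext b
  rw [mem_fiberExps, mem_range]
  constructor
  · rintro ⟨m, hm, rfl, rfl⟩
    exact (mem_compress hik).1 hm
  · intro h
    obtain ⟨c, hc⟩ := card_pos.1 (Nat.zero_lt_of_lt h)
    obtain ⟨a, ha, rfl, -⟩ := mem_fiberExps.1 hc
    have hb := h.trans_le (card_fiberExps_le hik A _)
    have h1 := moveVar_transfer hik a (c := b) (by omega)
    have h2 : transfer i k (moveVar i k a) b k = b := by
      rw [transfer_apply hik, if_pos rfl, moveVar_apply hik, if_pos rfl, zero_add]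
    exact ⟨_, (mem_compress hik).2 (by rwa [h1, h2]), h1, h2⟩

lemma exists_moveVar_eq_of_mem_compress {i k : Fin n} (hik : i ≠ k) {A : Finset (Fin n →₀ ℕ)}
    {m : Fin n →₀ ℕ} (hm : m ∈ compress i k A) : ∃ a ∈ A, moveVar i k a = moveVar i k m := by
  obtain ⟨b, hb⟩ := card_pos.1 (Nat.zero_lt_of_lt ((mem_compress hik).1 hm))
  obtain ⟨a, ha, hp, -⟩ := mem_fiberExps.1 hb
  exact ⟨a, ha, hp⟩

lemma sum_moveVar_eq {i k : Fin n} (hik : i ≠ k) {A : Finset (Fin n →₀ ℕ)}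
    {P : Finset (Fin n →₀ ℕ)} (hA : ∀ a ∈ A, moveVar i k a ∈ P)
    (g : (Fin n →₀ ℕ) → ℕ → ℕ) :
    ∑ m ∈ A, g (moveVar i k m) (m k) = ∑ p ∈ P, ∑ b ∈ fiberExps i k A p, g p b := by
  rw [← sum_fiberwise_of_maps_to hA]
  refine sum_congr rfl fun p _ => ?_
  rw [sum_fiberExps hik]
  refine sum_congr rfl fun m hm => ?_
  rw [(mem_filter.1 hm).2]

lemma moveVar_mem_image_of_mem_compress {i k : Fin n} (hik : i ≠ k) {A : Finset (Fin n →₀ ℕ)} :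
    ∀ m ∈ compress i k A, moveVar i k m ∈ A.image (moveVar i k) := fun m hm => by
  obtain ⟨a, ha, h⟩ := exists_moveVar_eq_of_mem_compress hik hm
  exact mem_image.2 ⟨a, ha, h⟩

lemma card_compress {i k : Fin n} (hik : i ≠ k) (A : Finset (Fin n →₀ ℕ)) :
    #(compress i k A) = #A := by
  have h1 := sum_moveVar_eq hik (moveVar_mem_image_of_mem_compress hik (A := A))
    (fun _ _ => 1)
  have h2 := sum_moveVar_eq hik (A := A) (fun _ h => mem_image_of_mem _ h) (fun _ _ => 1)
  simp only [sum_const, smul_eq_mul, mul_one, fiberExps_compress hik, card_range] at h1 h2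
  rw [h1, h2]

lemma compress_add_subset {i k : Fin n} (hik : i ≠ k) (A B : Finset (Fin n →₀ ℕ)) :
    compress i k A + compress i k B ⊆ compress i k (A + B) := by
  intro m hm
  obtain ⟨a, ha, b, hb, rfl⟩ := mem_add.1 hm
  rw [mem_compress hik] at ha hb ⊢
  -- Slices of sizes `r, s ≥ 1` have a sumset of size at least `r + s - 1`, and initial segments
  -- attain this.
  have h := cauchy_davenport_add_of_linearOrder_isCancelAdd
    (card_pos.1 (Nat.zero_lt_of_lt ha)) (card_pos.1 (Nat.zero_lt_of_lt hb))
  have h' := card_le_card (fiberExps_add_subset (i := i) (k := k) A B (moveVar i k a)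
    (moveVar i k b))
  rw [moveVar_add, Finsupp.add_apply]
  omega

lemma nsmul_compress_subset {i k : Fin n} (hik : i ≠ k) (A : Finset (Fin n →₀ ℕ)) (j : ℕ) :
    j • compress i k A ⊆ compress i k (j • A) := by
  induction j with
  | zero =>
    simp only [zero_nsmul]
    intro m hm
    rw [mem_zero] at hm
    subst hm
    rw [mem_compress hik, Finsupp.zero_apply, card_pos]
    exact ⟨0, mem_fiberExps.2 ⟨0, by simp, rfl, rfl⟩⟩
  | succ j ih =>
    rw [succ_nsmul, succ_nsmul]
    exact (add_subset_add_right ih).trans (compress_add_subset hik _ _)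

lemma card_nsmul_compress_le {i k : Fin n} (hik : i ≠ k) (A : Finset (Fin n →₀ ℕ)) (j : ℕ) :
    #(j • compress i k A) ≤ #(j • A) :=
  (card_le_card (nsmul_compress_subset hik A j)).trans_eq (card_compress hik _)

/-! ### Degree and weight under compression -/

lemma sum_moveVar {i k : Fin n} (m : Fin n →₀ ℕ) :
    ∑ t, moveVar i k m t = ∑ t, m t := by
  conv_rhs => rw [← Finsupp.erase_add_single k m]
  simp [moveVar, sum_add_distrib, Finsupp.single_apply]

lemma sum_val_mul_moveVar {i k : Fin n} (hik : i ≤ k) (m : Fin n →₀ ℕ) :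
    ∑ t : Fin n, (t : ℕ) * m t
      = ∑ t : Fin n, (t : ℕ) * moveVar i k m t + ((k : ℕ) - i) * m k := by
  conv_lhs => rw [← Finsupp.erase_add_single k m]
  simp only [moveVar, mul_add, sum_add_distrib, Finsupp.coe_add, Pi.add_apply,
    Finsupp.single_apply, mul_ite, mul_zero, sum_ite_eq, mem_univ, if_true, add_assoc]
  rw [← add_mul, Nat.add_sub_cancel' (by exact_mod_cast hik)]

/-- Equally many elements are missing from the segment as lie beyond it; the former are below `#B`,
the latter are not. -/
lemma sum_range_card_lt_sum {B : Finset ℕ} (h : B ≠ range #B) :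
    ∑ b ∈ range #B, b < ∑ b ∈ B, b := by
  have hcard : #(range #B \ B) = #(B \ range #B) := card_sdiff_comm (card_range _)
  have hne : (range #B \ B).Nonempty := by
    rw [sdiff_nonempty]
    exact fun hsub => h (eq_of_subset_of_card_le hsub (card_range _).ge).symm
  rw [← sum_inter_add_sum_sdiff (range #B) B, ← sum_inter_add_sum_sdiff B (range #B),
    inter_comm, add_lt_add_iff_left]
  calc ∑ b ∈ range #B \ B, b < ∑ _b ∈ range #B \ B, #B :=
        sum_lt_sum_of_nonempty hne fun b hb => mem_range.1 (mem_sdiff.1 hb).1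
    _ = ∑ _b ∈ B \ range #B, #B := by rw [sum_const, sum_const, hcard]
    _ ≤ ∑ b ∈ B \ range #B, b := sum_le_sum fun b hb => by
        simpa using (mem_sdiff.1 hb).2

lemma sum_range_card_le_sum (B : Finset ℕ) : ∑ b ∈ range #B, b ≤ ∑ b ∈ B, b := by
  by_cases h : B = range #B
  · rw [← h]
  · exact (sum_range_card_lt_sum h).le

/-- The total weight of a finite set of exponent vectors, where `x_t` has weight `t`. -/
noncomputable def totalWeight (A : Finset (Fin n →₀ ℕ)) : ℕ :=
  ∑ m ∈ A, ∑ t : Fin n, (t : ℕ) * m t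

lemma fiberExps_eq_range_of_totalWeight_le {i k : Fin n} (hik : i < k)
    {A : Finset (Fin n →₀ ℕ)} (h : totalWeight A ≤ totalWeight (compress i k A))
    {a : Fin n →₀ ℕ} (ha : a ∈ A) :
    fiberExps i k A (moveVar i k a) = range #(fiberExps i k A (moveVar i k a)) := by
  have key (A : Finset (Fin n →₀ ℕ)) (P) (hA : ∀ a ∈ A, moveVar i k a ∈ P) : totalWeight A =
      ∑ p ∈ P, (#(fiberExps i k A p) * ∑ t : Fin n, (t : ℕ) * p t +
        ((k : ℕ) - i) * ∑ b ∈ fiberExps i k A p, b) := by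
    have := sum_moveVar_eq hik.ne hA
      (fun p b => ∑ t : Fin n, (t : ℕ) * p t + ((k : ℕ) - i) * b)
    simp only [← sum_val_mul_moveVar hik.le] at this
    rw [totalWeight, this]
    simp [sum_add_distrib, mul_sum]
  rw [key A _ (fun _ h => mem_image_of_mem _ h),
    key _ _ (moveVar_mem_image_of_mem_compress hik.ne)] at h
  simp only [fiberExps_compress hik.ne, card_range, sum_add_distrib] at h
  have hki : 0 < (k : ℕ) - i := Nat.sub_pos_of_lt hik
  -- Slice sizes are unchanged, so only the sums of the `x_k`-exponents remain to compare.
  rw [← mul_sum, ← mul_sum, add_le_add_iff_left, Nat.mul_le_mul_left_iff hki] at h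
  by_contra hne
  exact absurd h (not_le.2 (sum_lt_sum (fun p _ => sum_range_card_le_sum _)
    ⟨_, mem_image_of_mem _ ha, sum_range_card_lt_sum hne⟩))

lemma mem_of_totalWeight_le {i k : Fin n} (hik : i < k)
    {A : Finset (Fin n →₀ ℕ)} (h : totalWeight A ≤ totalWeight (compress i k A))
    {a : Fin n →₀ ℕ} (ha : a ∈ A) (hk : 0 < a k) :
    a - Finsupp.single k 1 + Finsupp.single i 1 ∈ A := by
  have hr := fiberExps_eq_range_of_totalWeight_le hik h ha
  have hak : a k ∈ fiberExps i k A (moveVar i k a) := mem_fiberExps.2 ⟨a, ha, rfl, rfl⟩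
  -- The stable move stays on the line of `a` and lowers the `x_k`-exponent by one.
  have hb : a k - 1 ∈ fiberExps i k A (moveVar i k a) := by
    rw [hr, mem_range] at hak ⊢
    omega
  obtain ⟨b, hbA, hp, hbk⟩ := mem_fiberExps.1 hb
  convert! hbA using 1
  refine eq_of_moveVar_eq hik.ne ?_ ?_
  · rw [hp]
    ext t
    simp only [moveVar_apply hik.ne, Finsupp.add_apply, Finsupp.tsub_apply, Finsupp.single_apply]
    by_cases htk : t = k
    · simp [htk]
    · by_cases hti : t = i
      · simp [hti, hik.ne, hik.ne']
        omega
      · simp [htk, hti, Ne.symm htk, Ne.symm hti]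
  · simp [hbk, hik.ne]

lemma sum_eq_of_mem_compress {i k : Fin n} (hik : i ≠ k) {A : Finset (Fin n →₀ ℕ)} {d : ℕ}
    (hA : ∀ a ∈ A, ∑ t, a t = d) {m : Fin n →₀ ℕ} (hm : m ∈ compress i k A) :
    ∑ t, m t = d := by
  obtain ⟨a, ha, h⟩ := exists_moveVar_eq_of_mem_compress hik hm
  rw [← sum_moveVar (i := i) (k := k), ← h, sum_moveVar, hA a ha]

/-! ### Leading exponents and dimension -/

open MvPolynomial

section Lead

variable {σ K : Type*} [Field K] (ord : MonomialOrder σ)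

/-- The exponents of the leading monomials of the nonzero elements of `V`. -/
def leadExps (V : Submodule K (MvPolynomial σ K)) : Set (σ →₀ ℕ) :=
  {s | ∃ f ∈ V, f ≠ 0 ∧ ord.degree f = s}

lemma card_le_finrank_of_subset_leadExps {V : Submodule K (MvPolynomial σ K)}
    [FiniteDimensional K V] {T : Finset (σ →₀ ℕ)} (hT : (T : Set (σ →₀ ℕ)) ⊆ leadExps ord V) :
    #T ≤ Module.finrank K V := by
  classical
  choose f hfV hf0 hfd using fun s : T => hT s.2
  have hli : LinearIndependent K (fun s : T => (⟨f s, hfV s⟩ : V)) := by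
    rw [Fintype.linearIndependent_iff]
    intro c hc
    by_contra! hne
    have hne' : (univ.filter fun s : T => c s ≠ 0).Nonempty := by
      obtain ⟨s, hs⟩ := hne
      exact ⟨s, by simpa using hs⟩
    -- The largest leading monomial in a relation cannot cancel.
    obtain ⟨s, hs, hmax⟩ := exists_max_image _ (fun s : T => ord.toSyn s) hne'
    have hcoe : ∑ t : T, c t • f t = 0 := by
      simpa using congrArg Subtype.val hc
    have h0 := congrArg (coeff (s : σ →₀ ℕ)) hcoe
    rw [coeff_sum, sum_eq_single s, coeff_smul, coeff_zero, smul_eq_mul] at h0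
    · refine mul_ne_zero (mem_filter.1 hs).2 ?_ h0
      rw [← hfd s]
      exact ord.coeff_degree_ne_zero_iff.2 (hf0 s)
    · intro t _ hts
      rw [coeff_smul]
      by_cases hct : c t = 0
      · rw [hct, zero_smul]
      · rw [ord.coeff_eq_zero_of_lt, smul_zero]
        rw [hfd t]
        refine lt_of_le_of_ne (hmax t (by simpa using hct)) fun h => hts ?_
        exact Subtype.ext (ord.toSyn.injective h)
    · simp
  simpa using hli.fintype_card_le_finrank

lemma finrank_le_card_of_leadExps_subset {V : Submodule K (MvPolynomial σ K)}
    {T : Finset (σ →₀ ℕ)} (hT : leadExps ord V ⊆ T) : Module.finrank K V ≤ #T := by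
  let φ : V →ₗ[K] (T → K) := LinearMap.pi fun s => lcoeff K (s : σ →₀ ℕ) ∘ₗ V.subtype
  have hφ : Function.Injective φ := by
    rw [← LinearMap.ker_eq_bot, LinearMap.ker_eq_bot']
    intro f hf
    by_contra hne
    have hne' : (f : MvPolynomial σ K) ≠ 0 := fun h => hne (Subtype.ext h)
    exact ord.coeff_degree_ne_zero_iff.2 hne' (congrFun hf ⟨_, hT ⟨f, f.2, hne', rfl⟩⟩)
  simpa using LinearMap.finrank_le_finrank_of_injective hφ

lemma leadExps_add_subset (V W : Submodule K (MvPolynomial σ K)) :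
    leadExps ord V + leadExps ord W ⊆ leadExps ord (V * W) := by
  rintro _ ⟨_, ⟨f, hf, hf0, rfl⟩, _, ⟨g, hg, hg0, rfl⟩, rfl⟩
  exact ⟨f * g, Submodule.mul_mem_mul hf hg, mul_ne_zero hf0 hg0, ord.degree_mul hf0 hg0⟩

lemma nsmul_leadExps_subset (V : Submodule K (MvPolynomial σ K)) (j : ℕ) :
    j • leadExps ord V ⊆ leadExps ord (V ^ j) := by
  induction j with
  | zero =>
    rw [zero_nsmul, pow_zero]
    rintro _ rfl
    exact ⟨1, Submodule.one_le.1 le_rfl, one_ne_zero, ord.degree_one⟩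
  | succ j ih =>
    rw [succ_nsmul, pow_succ]
    exact (Set.add_subset_add_right ih).trans (leadExps_add_subset ord _ _)

end Lead

/-! ### Monomial subspaces -/

section Monomial

variable (K : Type*) [Field K]

lemma monomialSubspace_eq_restrictSupport (A : Set (Fin n →₀ ℕ)) :
    monomialSubspace K A = restrictSupport K A :=
  (restrictSupport_eq_span K A).symm

lemma monomialSubspace_pow (A : Set (Fin n →₀ ℕ)) (j : ℕ) :
    monomialSubspace K A ^ j = monomialSubspace K (j • A) := by
  simp only [monomialSubspace_eq_restrictSupport]
  induction j with
  | zero => rw [pow_zero, zero_nsmul, restrictSupport_zero]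
  | succ j ih => rw [pow_succ, succ_nsmul, restrictSupport_add, ih]

lemma finrank_monomialSubspace (A : Finset (Fin n →₀ ℕ)) :
    Module.finrank K (monomialSubspace K (A : Set (Fin n →₀ ℕ))) = #A := by
  rw [monomialSubspace_eq_restrictSupport,
    Module.finrank_eq_card_basis (basisRestrictSupport K (A : Set (Fin n →₀ ℕ)))]
  simp

lemma finrank_monomialSubspace_pow (A : Finset (Fin n →₀ ℕ)) (j : ℕ) :
    Module.finrank K (monomialSubspace K (A : Set (Fin n →₀ ℕ)) ^ j :
      Submodule K (MvPolynomial (Fin n) K)) = #(j • A) := by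
  rw [monomialSubspace_pow, ← coe_nsmul, finrank_monomialSubspace]

lemma monomial_mem_monomialSubspace {A : Set (Fin n →₀ ℕ)} {m : Fin n →₀ ℕ} :
    monomial m (1 : K) ∈ monomialSubspace K A ↔ m ∈ A := by
  rw [monomialSubspace_eq_restrictSupport, monomial_mem_restrictSupport]
  simp

end Monomial

/-! ### The minimum over sets of monomials -/

lemma mem_exponents_iff {d : ℕ} {m : Fin n →₀ ℕ} :
    m ∈ (univ : Finset (Fin n)).finsuppAntidiag d ↔ ∑ t, m t = d := by
  simp [mem_finsuppAntidiag]

lemma monomialSubspace_mem_grassmannian (K : Type*) [Field K] {d u : ℕ}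
    {A : Finset (Fin n →₀ ℕ)} (hA : ∀ a ∈ A, ∑ t, a t = d) (hu : #A = u) :
    monomialSubspace K (A : Set (Fin n →₀ ℕ)) ∈ grassmannian K n d u := by
  refine ⟨Submodule.span_le.2 ?_, (finrank_monomialSubspace K A).trans hu⟩
  rintro _ ⟨a, ha, rfl⟩
  refine isHomogeneous_monomial _ ?_
  rw [Finsupp.degree_eq_sum, hA a ha]

/-- Every `u`-dimensional space of forms of degree `d` is bounded below, as regards the dimension
of its powers, by a set of `u` monomials. -/
lemma exists_card_nsmul_le_finrank_pow {K : Type*} [Field K] {d u : ℕ}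
    {V : Submodule K (MvPolynomial (Fin n) K)} (hV : V ∈ grassmannian K n d u) (j : ℕ) :
    ∃ A : Finset (Fin n →₀ ℕ), (∀ a ∈ A, ∑ t, a t = d) ∧ #A = u ∧
      #(j • A) ≤ Module.finrank K (V ^ j : Submodule K (MvPolynomial (Fin n) K)) := by
  let ord : MonomialOrder (Fin n) := MonomialOrder.lex
  have hV' : V ≤ restrictSupport K
      ((univ : Finset (Fin n)).finsuppAntidiag d : Set (Fin n →₀ ℕ)) := fun f hf a ha => by
    have h := (hV.1 hf : f.IsHomogeneous d) (mem_support_iff.1 ha)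
    rw [mem_coe, mem_exponents_iff, ← Finsupp.degree_eq_sum, Finsupp.degree_eq_weight_one]
    exact h
  have hsub : leadExps ord V ⊆ (univ : Finset (Fin n)).finsuppAntidiag d := by
    rintro _ ⟨f, hf, hf0, rfl⟩
    exact hV' hf (ord.degree_mem_support hf0)
  have hfin : (leadExps ord V).Finite := (finite_toSet _).subset hsub
  have hle := finrank_le_card_of_leadExps_subset ord (V := V) (T := hfin.toFinset) (by simp)
  rw [hV.2] at hle
  obtain ⟨A, hAT, hA⟩ := exists_subset_card_eq hle
  have hAV : (A : Set (Fin n →₀ ℕ)) ⊆ leadExps ord V := fun a ha => hfin.mem_toFinset.1 (hAT ha)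
  refine ⟨A, fun a ha => mem_exponents_iff.1 (hsub (hAV ha)), hA, ?_⟩
  -- Finiteness is needed since `finrank` defaults to 0.
  have := Module.Finite.of_basis (basisRestrictSupport K
    ((univ : Finset (Fin n)).finsuppAntidiag d : Set (Fin n →₀ ℕ)))
  have : FiniteDimensional K V := Submodule.finiteDimensional_of_le hV'
  have : FiniteDimensional K (V ^ j : Submodule K (MvPolynomial (Fin n) K)) :=
    Module.Finite.iff_fg.2 ((Module.Finite.iff_fg.1 this).pow j)
  refine card_le_finrank_of_subset_leadExps ord ?_
  rw [coe_nsmul]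
  exact (Set.nsmul_subset_nsmul_left hAV).trans (nsmul_leadExps_subset ord V j)

lemma exists_minimal_card_nsmul (n d u j : ℕ) (hud : u ≤ (n + d - 1).choose d) :
    ∃ A : Finset (Fin n →₀ ℕ), (∀ a ∈ A, ∑ t, a t = d) ∧ #A = u ∧
      (∀ B : Finset (Fin n →₀ ℕ), (∀ a ∈ B, ∑ t, a t = d) → #B = u → #(j • A) ≤ #(j • B)) ∧
      ∀ a ∈ A, ∀ i k : Fin n, i < k → 0 < a k →
        a - Finsupp.single k 1 + Finsupp.single i 1 ∈ A := by
  have hmem (B : Finset (Fin n →₀ ℕ)) :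
      B ∈ powersetCard u ((univ : Finset (Fin n)).finsuppAntidiag d) ↔
        (∀ a ∈ B, ∑ t, a t = d) ∧ #B = u := by
    simp only [mem_powersetCard, subset_iff, mem_exponents_iff]
  have hne : (powersetCard u ((univ : Finset (Fin n)).finsuppAntidiag d)).Nonempty := by
    rw [powersetCard_nonempty, card_finsuppAntidiag_nat_eq_choose]
    simpa using hud
  obtain ⟨A, hA, hmin⟩ := exists_min_image _
    (fun B : Finset (Fin n →₀ ℕ) => toLex (#(j • B), totalWeight B)) hne
  obtain ⟨hAd, hAu⟩ := (hmem A).1 hA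
  refine ⟨A, hAd, hAu, fun B hBd hBu => ?_, fun a ha i k hik hk => ?_⟩
  · rcases Prod.Lex.toLex_le_toLex.1 (hmin B ((hmem B).2 ⟨hBd, hBu⟩)) with h | h
    exacts [h.le, h.1.le]
  · refine mem_of_totalWeight_le hik ?_ ha hk
    have hC := (hmem (compress i k A)).2 ⟨fun m hm => sum_eq_of_mem_compress hik.ne hAd hm,
      (card_compress hik.ne A).trans hAu⟩
    -- The first coordinate cannot grow under compression, so minimality compares weights.
    rcases Prod.Lex.toLex_le_toLex.1 (hmin _ hC) with h | h
    exacts [absurd h (card_nsmul_compress_le hik.ne A j).not_gt, h.2]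

lemma minPowerDim_eq_card_nsmul (K : Type*) [Field K] {d u j : ℕ} {A : Finset (Fin n →₀ ℕ)}
    (hAd : ∀ a ∈ A, ∑ t, a t = d) (hAu : #A = u)
    (hmin : ∀ B : Finset (Fin n →₀ ℕ), (∀ a ∈ B, ∑ t, a t = d) → #B = u →
      #(j • A) ≤ #(j • B)) : minPowerDim K n d u j = #(j • A) := by
  have hG := monomialSubspace_mem_grassmannian K hAd hAu
  -- `hG` also gives the nonemptiness without which `sInf` would be 0.
  refine le_antisymm (Nat.sInf_le ⟨_, hG, (finrank_monomialSubspace_pow K A j).symm⟩)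
    (le_csInf ⟨_, _, hG, rfl⟩ ?_)
  rintro _ ⟨V, hV, rfl⟩
  obtain ⟨B, hBd, hBu, hB⟩ := exists_card_nsmul_le_finrank_pow hV j
  exact (hmin B hBd hBu).trans hB

lemma isStronglyStable_monomialSubspace (K : Type*) [Field K] {A : Set (Fin n →₀ ℕ)}
    (hA : ∀ a ∈ A, ∀ i k : Fin n, i < k → 0 < a k →
      a - Finsupp.single k 1 + Finsupp.single i 1 ∈ A) :
    IsStronglyStable (monomialSubspace K A) := by
  refine ⟨⟨A, rfl⟩, fun m hm i k hik hk => ?_⟩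
  rw [monomial_mem_monomialSubspace] at hm ⊢
  exact hA m hm i k hik hk

end PowersOfForms

theorem mainTheorem1 (n d u j : ℕ) (hn : 0 < n) (hd : 0 < d) (hu : 0 < u) (hj : 0 < j)
    (hud : u ≤ (n + d - 1).choose d) :
    ∃ (A : Finset (Fin n →₀ ℕ)) (l : ℕ), ∀ (K : Type*) [Field K],
      PowersOfForms.monomialSubspace K (A : Set (Fin n →₀ ℕ)) ∈
        PowersOfForms.grassmannian K n d u ∧
      PowersOfForms.IsStronglyStable
        (PowersOfForms.monomialSubspace K (A : Set (Fin n →₀ ℕ))) ∧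
      PowersOfForms.minPowerDim K n d u j =
        Module.finrank K (PowersOfForms.monomialSubspace K (A : Set (Fin n →₀ ℕ)) ^ j :
          Submodule K (MvPolynomial (Fin n) K)) ∧
      PowersOfForms.minPowerDim K n d u j = l := by
  obtain ⟨A, hAd, hAu, hmin, hstable⟩ := PowersOfForms.exists_minimal_card_nsmul n d u j hud
  refine ⟨A, open scoped Pointwise in (j • A).card, fun K _ => ?_⟩
  have hL := PowersOfForms.minPowerDim_eq_card_nsmul K hAd hAu hmin
  exact ⟨PowersOfForms.monomialSubspace_mem_grassmannian K hAd hAu,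
    PowersOfForms.isStronglyStable_monomialSubspace K hstable,
    hL.trans (PowersOfForms.finrank_monomialSubspace_pow K A j).symm, hL⟩
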